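/- Let $\mathcal{S}_{++}^n$ be the space of real symmetric positive definite $n\times n$ matrices, with its usual topology. For $X,Y\in\mathcal{S}_{++}^n$ let $$\delta_g(X,Y)=\bigl\|\log\bigl(Y^{-1/2}XY^{-1/2}\bigr)\bigr\|_F$$ be the geodesic distance of the affine-invariant Riemannian metric $\langle v,w\rangle_P=\operatorname{Tr}(P^{-1}vP^{-1}w)$ (AIRM), where $\log$ is the principal matrix logarithm and $\|\cdot\|_F$ the Frobenius norm, and let $$\delta_S(X,Y)=\Bigl(\ln\det\Bigl(\frac{X+Y}{2}\Bigr)-\frac12\ln\det(XY)\Bigr)^{1/2}$$ be the Stein metric. For a curve, i.e. a continuous map $\gamma:[0,1]\to\mathcal{S}_{++}^n$, its length under $\delta\in\{\delta_g,\delta_S\}$ is $$L_\delta(\gamma)=\sup\Bigl\{\sum_{i=1}^{k}\delta\bigl(\gamma(t_i),\gamma(t_{i-1})\bigr)\;:\;k\ge 1,\ 0=t_0<t_1<\cdots<t_k=1\Bigr\}\in[0,\infty].$$ Then, for every $n$ and every curve $\gamma$ in $\mathcal{S}_{++}^n$, $$L_{\delta_g}(\gamma)=2\sqrt2\;L_{\delta_S}(\gamma).$$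 In particular, one of the two lengths is finite if and only if the other is. -/

import Mathlib

open scoped ENNReal

/-- The space of real symmetric positive definite `n × n` matrices, with the topology inherited
from the space of all `n × n` matrices. -/
abbrev SPD (n : ℕ) : Type := {X : Matrix (Fin n) (Fin n) ℝ // X.PosDef}

/-- The Frobenius norm of a real square matrix. -/
noncomputable def frobeniusNorm {n : ℕ} (A : Matrix (Fin n) (Fin n) ℝ) : ℝ :=
  Real.sqrt (∑ i, ∑ j, A i j ^ 2)

/-- The symmetric positive definite square root `X ^ (1/2)` of a positive definite matrix,
through the spectral functional calculus. -/
noncomputable def matrixSqrt {n : ℕ} (X : Matrix (Fin n) (Fin n) ℝ) : Matrix (Fin n) (Fin n) ℝ :=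
  cfc Real.sqrt X

/-- The principal logarithm of a positive definite matrix, through the spectral functional
calculus. -/
noncomputable def matrixLog {n : ℕ} (X : Matrix (Fin n) (Fin n) ℝ) : Matrix (Fin n) (Fin n) ℝ :=
  cfc Real.log X

/-- The geodesic distance of the affine-invariant Riemannian metric,
`δ_g(X, Y) = ‖log (Y ^ (-1/2) * X * Y ^ (-1/2))‖_F`. The argument of the logarithm is positive
definite and similar to `X * Y⁻¹`. -/
noncomputable def airmDist {n : ℕ} (X Y : SPD n) : ℝ :=
  frobeniusNorm (matrixLog ((matrixSqrt Y.1)⁻¹ * X.1 * (matrixSqrt Y.1)⁻¹))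

/-- The S-divergence `ln det ((X + Y) / 2) - (1 / 2) ln det (X Y)`. -/
noncomputable def steinDivergence {n : ℕ} (X Y : SPD n) : ℝ :=
  Real.log (((1 / 2 : ℝ) • (X.1 + Y.1)).det) - 1 / 2 * Real.log ((X.1 * Y.1).det)

/-- The Stein metric: the square root of the S-divergence. -/
noncomputable def steinDist {n : ℕ} (X Y : SPD n) : ℝ :=
  Real.sqrt (steinDivergence X Y)

/-- The length of a curve `γ : [0, 1] → M` under a distance function `d`: the supremum, possibly
infinite, over all partitions `0 = t₀ < t₁ < ⋯ < tₖ = 1` of `∑ i, d (γ (tᵢ), γ (tᵢ₋₁))`. -/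
noncomputable def curveLength {M : Type*} (d : M → M → ℝ) (γ : unitInterval → M) : ℝ≥0∞ :=
  ⨆ (k : ℕ) (t : Fin (k + 1) → unitInterval)
    (_ : StrictMono t ∧ t 0 = 0 ∧ t (Fin.last k) = 1),
    ENNReal.ofReal (∑ i : Fin k, d (γ (t i.succ)) (γ (t i.castSucc)))

/-!
Let `u` be the vector of logarithms of the eigenvalues of `X` relative to `Y`. Then
`airmDist X Y ^ 2 = ∑ uᵢ²` and `steinDivergence X Y = ∑ log cosh (uᵢ / 2)`
(`exists_relative_log_eigenvalues`). Since `log cosh x ≤ x² / 2`, always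
`2√2 * steinDist ≤ airmDist`, which gives one inequality between the lengths. Conversely
`log cosh x` is asymptotic to `x² / 2` at `0`, so for each `κ > 0` one has
`airmDist ≤ √(8 (1 + κ)) * steinDist` as soon as the Stein divergence is small
(`airmDist_le_mul_steinDist`). The divergence is continuous and vanishes on the diagonal, so by
compactness of `[0, 1]` it is small along `γ` at uniformly close parameters. Refining any partition
to such a mesh does not decrease the sums of `airmDist`, because `airmDist` satisfies the triangle
inequality; letting `κ → 0` gives the other inequality (`curveLength_le_of_local_le`). The triangle
inequality for the Stein metric is not used.

The substantial point is the triangle inequality for `airmDist` (`airmDist_triangle`). By congruence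
invariance it may be assumed that `Z = 1` and that `X` is diagonal with increasing logarithmic
eigenvalues `a`, so that `airmDist X Z = ‖a‖`. Let `N` be lower triangular with `N Y Nᵀ = 1`, and
let `C = N X Nᵀ`, so that `airmDist X Y = ‖log C‖_F`. For each leading principal block, indicated by
a subscript `k`, the triangular factors cancel and `det Yₖ * det Cₖ = det Xₖ`. A trace form of
Jensen's inequality (`trace_compress_cfc_log_le`) gives `tr (log Y)ₖ ≤ log det Yₖ`, and likewise
for `C`, with equality for the full block. Hence the diagonal of `log Y + log C` has partial sums
at most those of `a`, and the same total. Abel summation against the increasing weights `a` yields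
`‖a‖² ≤ ∑ aᵢ (log Y + log C)ᵢᵢ`, and Cauchy–Schwarz bounds the right side by
`‖a‖ (‖log Y‖_F + ‖log C‖_F)`.
-/

open Matrix

/-! ### Spectral calculus and Jensen's inequality for the logarithm -/

section SpectralCalculus

variable {m ι : Type*} [Fintype m] [DecidableEq m] [DecidableEq ι]

theorem posDef_conj {A B : Matrix m m ℝ} (hA : A.PosDef) (hB : IsUnit B) :
    (B * A * Bᵀ).PosDef := by
  have := (Matrix.IsUnit.posDef_star_right_conjugate_iff (x := A) hB).2 hA
  rwa [star_eq_conjTranspose, conjTranspose_eq_transpose_of_trivial] at this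

/-- The functional calculus can be computed in any orthogonal diagonalization. -/
theorem cfc_orthogonal_diagonal (f : ℝ → ℝ) {U : Matrix m m ℝ} (hU : Uᵀ * U = 1) (d : m → ℝ) :
    cfc f (U * diagonal d * Uᵀ) = U * diagonal (fun i => f (d i)) * Uᵀ := by
  have hU' : U * Uᵀ = 1 := mul_eq_one_comm.1 hU
  have hA : (U * diagonal d * Uᵀ).IsHermitian := by
    rw [IsHermitian, conjTranspose_eq_transpose_of_trivial]
    simp [transpose_mul, Matrix.mul_assoc]
  set A := U * diagonal d * Uᵀ with hAdef
  rw [hA.cfc_eq, IsHermitian.cfc]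
  have hs := hA.spectral_theorem
  rw [Unitary.conjStarAlgAut_apply] at hs ⊢
  have hV1 : (star (hA.eigenvectorUnitary : Matrix m m ℝ)) * hA.eigenvectorUnitary = 1 := by simp
  have hV2 : (hA.eigenvectorUnitary : Matrix m m ℝ) *
      star (hA.eigenvectorUnitary : Matrix m m ℝ) = 1 := by
    simp
  set l := hA.eigenvalues
  generalize (hA.eigenvectorUnitary : Matrix m m ℝ) = V at hs hV1 hV2 ⊢
  -- `W` intertwines the two diagonal forms, so it is supported where the eigenvalues agree.
  set W := star V * U with hW
  have h1 : diagonal l * W = W * diagonal d := by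
    have : star V * A * U = star V * (U * diagonal d * Uᵀ) * U := by rw [hAdef]
    rw [hs] at this
    calc diagonal l * W = star V * (V * diagonal l * star V) * U := by
          simp only [hW, ← Matrix.mul_assoc, hV1, Matrix.one_mul]
      _ = star V * (U * diagonal d * Uᵀ) * U := this
      _ = W * diagonal d * (Uᵀ * U) := by simp only [hW, Matrix.mul_assoc]
      _ = W * diagonal d := by rw [hU, Matrix.mul_one]
  have h2 : diagonal (fun i => f (l i)) * W = W * diagonal (fun i => f (d i)) := by
    ext i j
    have hij := congrFun (congrFun h1 i) j
    rw [diagonal_mul, mul_diagonal] at hij ⊢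
    rcases eq_or_ne (W i j) 0 with h | h
    · simp [h]
    · have : l i = d j := by
        rw [mul_comm] at hij
        exact mul_left_cancel₀ h hij
      rw [this, mul_comm]
  calc V * diagonal (fun i => f (l i)) * star V
      = V * (diagonal (fun i => f (l i)) * W) * Uᵀ := by
        simp only [hW, Matrix.mul_assoc, hU', Matrix.mul_one]
    _ = (V * star V) * U * diagonal (fun i => f (d i)) * Uᵀ := by
        rw [h2]; simp only [hW, Matrix.mul_assoc]
    _ = U * diagonal (fun i => f (d i)) * Uᵀ := by rw [hV2, Matrix.one_mul]

/-- The spectral theorem, with the eigenvalues of `P` written as exponentials. -/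
theorem exists_orthogonal_exp {P : Matrix m m ℝ} (hP : P.PosDef) :
    ∃ (U : Matrix m m ℝ) (h : m → ℝ), Uᵀ * U = 1 ∧
      P = U * diagonal (fun i => Real.exp (h i)) * Uᵀ := by
  refine ⟨hP.1.eigenvectorUnitary, fun i => Real.log (hP.1.eigenvalues i), ?_, ?_⟩
  · rw [← conjTranspose_eq_transpose_of_trivial, ← star_eq_conjTranspose]
    simp
  · rw [← conjTranspose_eq_transpose_of_trivial, ← star_eq_conjTranspose]
    have hs := hP.1.spectral_theorem
    rw [Unitary.conjStarAlgAut_apply] at hs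
    simp only [Real.exp_log (hP.eigenvalues_pos _)]
    exact hs

theorem cfc_log_orthogonal_exp {U : Matrix m m ℝ} (hU : Uᵀ * U = 1) (h : m → ℝ) :
    cfc Real.log (U * diagonal (fun i => Real.exp (h i)) * Uᵀ) = U * diagonal h * Uᵀ := by
  simp [cfc_orthogonal_diagonal _ hU]

theorem cfc_log_orthogonal_conj {P Q : Matrix m m ℝ} (hP : P.PosDef) (hQ : Qᵀ * Q = 1) :
    cfc Real.log (Q * P * Qᵀ) = Q * cfc Real.log P * Qᵀ := by
  obtain ⟨U, h, hU, rfl⟩ := exists_orthogonal_exp hP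
  have hQU : (Q * U)ᵀ * (Q * U) = 1 := by
    rw [transpose_mul, Matrix.mul_assoc, ← Matrix.mul_assoc Qᵀ, hQ, Matrix.one_mul, hU]
  have := cfc_log_orthogonal_exp hQU h
  rw [cfc_log_orthogonal_exp hU]
  simpa only [transpose_mul, Matrix.mul_assoc] using this

theorem trace_cfc_log {P : Matrix m m ℝ} (hP : P.PosDef) :
    (cfc Real.log P).trace = Real.log P.det := by
  obtain ⟨U, h, hU, rfl⟩ := exists_orthogonal_exp hP
  have hd : U.det * U.det = 1 := by
    simpa using congrArg det hU
  rw [cfc_log_orthogonal_exp hU, trace_mul_cycle, hU, Matrix.one_mul, trace_diagonal,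
    det_mul, det_mul, det_transpose, mul_right_comm, hd, one_mul, det_diagonal,
    ← Real.exp_sum, Real.log_exp]

/-- Jensen's inequality for the concave function `log` and the spectral measure of `P` at each
unit column of `F`. -/
theorem cfc_log_compress_diag_le {P : Matrix m m ℝ} (hP : P.PosDef) {F : Matrix m ι ℝ}
    (hF : Fᵀ * F = 1) (j : ι) :
    (Fᵀ * cfc Real.log P * F) j j ≤ Real.log ((Fᵀ * P * F) j j) := by
  obtain ⟨U, h, hU, rfl⟩ := exists_orthogonal_exp hP
  have hU' : U * Uᵀ = 1 := mul_eq_one_comm.1 hU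
  rw [cfc_log_orthogonal_exp hU]
  set G := Uᵀ * F with hG
  have hquad : ∀ d : m → ℝ, (Fᵀ * (U * diagonal d * Uᵀ) * F) j j = ∑ i, G i j ^ 2 * d i := by
    intro d
    have : Fᵀ * (U * diagonal d * Uᵀ) * F = Gᵀ * diagonal d * G := by
      simp only [hG, transpose_mul, transpose_transpose, Matrix.mul_assoc]
    rw [this, mul_apply]
    refine Finset.sum_congr rfl fun i _ => ?_
    rw [mul_diagonal, transpose_apply]; ring
  have hone : ∑ i, G i j ^ 2 = 1 := by
    have : Gᵀ * G = 1 := by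
      rw [hG, transpose_mul, transpose_transpose, Matrix.mul_assoc, ← Matrix.mul_assoc U, hU',
        Matrix.one_mul, hF]
    have := congrFun (congrFun this j) j
    rw [mul_apply, one_apply_eq] at this
    simpa [pow_two] using this
  rw [hquad, hquad]
  have hJ := convexOn_exp.map_sum_le (t := Finset.univ) (w := fun i => G i j ^ 2) (p := h)
    (fun i _ => sq_nonneg _) hone (fun i _ => Set.mem_univ _)
  simp only [smul_eq_mul] at hJ
  rw [Real.le_log_iff_exp_le (lt_of_lt_of_le (Real.exp_pos _) hJ)]
  exact hJ

/-- The trace form of the operator Jensen inequality for `log`, for a compression by an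
isometry `E`. -/
theorem trace_compress_cfc_log_le [Fintype ι] {P : Matrix m m ℝ} (hP : P.PosDef) {E : Matrix m ι ℝ}
    (hE : Eᵀ * E = 1) :
    (Eᵀ * cfc Real.log P * E).trace ≤ Real.log (Eᵀ * P * E).det := by
  have hinj : Function.Injective E.mulVec := fun x y hxy => by
    simpa [mulVec_mulVec, hE] using congrArg (Eᵀ *ᵥ ·) hxy
  have hPE : (Eᵀ * P * E).PosDef := by
    have := hP.conjTranspose_mul_mul_same hinj
    rwa [conjTranspose_eq_transpose_of_trivial] at this
  obtain ⟨V, d, hV, hVd⟩ := exists_orthogonal_exp hPE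
  have hV' : V * Vᵀ = 1 := mul_eq_one_comm.1 hV
  have hF : (E * V)ᵀ * (E * V) = 1 := by
    rw [transpose_mul, Matrix.mul_assoc, ← Matrix.mul_assoc Eᵀ, hE, Matrix.one_mul, hV]
  have hdiag : (E * V)ᵀ * P * (E * V) = diagonal (fun i => Real.exp (d i)) := by
    calc (E * V)ᵀ * P * (E * V) = Vᵀ * (Eᵀ * P * E) * V := by
          simp only [transpose_mul, Matrix.mul_assoc]
      _ = (Vᵀ * V) * diagonal (fun i => Real.exp (d i)) * (Vᵀ * V) := by
          rw [hVd]; simp only [Matrix.mul_assoc]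
      _ = _ := by rw [hV, Matrix.one_mul, Matrix.mul_one]
  have htr : (Eᵀ * cfc Real.log P * E).trace = ((E * V)ᵀ * cfc Real.log P * (E * V)).trace := by
    have : (E * V)ᵀ * cfc Real.log P * (E * V) = Vᵀ * (Eᵀ * cfc Real.log P * E) * V := by
      simp only [transpose_mul, Matrix.mul_assoc]
    rw [this, trace_mul_comm _ V, ← Matrix.mul_assoc, ← Matrix.mul_assoc, hV', Matrix.one_mul]
  rw [htr, ← trace_cfc_log hPE, hVd, cfc_log_orthogonal_exp hV, trace_mul_cycle V, hV,
    Matrix.one_mul, trace_diagonal, trace]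
  refine Finset.sum_le_sum fun j _ => (cfc_log_compress_diag_le hP hF j).trans_eq ?_
  rw [hdiag, diagonal_apply_eq, Real.log_exp]

theorem trace_submatrix_cfc_log_le [Fintype ι] {P : Matrix m m ℝ} (hP : P.PosDef) {e : ι → m}
    (he : Function.Injective e) :
    ∑ j, cfc Real.log P (e j) (e j) ≤ Real.log (P.submatrix e e).det := by
  have hE : ((1 : Matrix m m ℝ).submatrix id e)ᵀ * (1 : Matrix m m ℝ).submatrix id e = 1 := by
    ext i j
    simp [mul_apply, one_apply, he.eq_iff]
  have hsub : ∀ A : Matrix m m ℝ,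
      ((1 : Matrix m m ℝ).submatrix id e)ᵀ * A * (1 : Matrix m m ℝ).submatrix id e
        = A.submatrix e e := by
    intro A
    ext i j
    simp [mul_apply, one_apply]
  have := trace_compress_cfc_log_le hP hE
  rwa [hsub, hsub] at this

end SpectralCalculus

/-! ### The Frobenius norm -/

section Frobenius

variable {n : ℕ}

theorem frobeniusNorm_nonneg (A : Matrix (Fin n) (Fin n) ℝ) : 0 ≤ frobeniusNorm A :=
  Real.sqrt_nonneg _

theorem frobeniusNorm_eq_sqrt_trace (A : Matrix (Fin n) (Fin n) ℝ) :
    frobeniusNorm A = Real.sqrt (A * Aᵀ).trace := by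
  simp [frobeniusNorm, trace, mul_apply, pow_two]

theorem frobeniusNorm_orthogonal_conj {Q : Matrix (Fin n) (Fin n) ℝ} (hQ : Qᵀ * Q = 1)
    (A : Matrix (Fin n) (Fin n) ℝ) : frobeniusNorm (Q * A * Qᵀ) = frobeniusNorm A := by
  have h : Q * A * Qᵀ * (Q * A * Qᵀ)ᵀ = Q * (A * Aᵀ) * Qᵀ := by
    calc Q * A * Qᵀ * (Q * A * Qᵀ)ᵀ = Q * A * (Qᵀ * Q) * Aᵀ * Qᵀ := by
          simp only [transpose_mul, transpose_transpose, Matrix.mul_assoc]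
      _ = _ := by rw [hQ, Matrix.mul_one]; simp only [Matrix.mul_assoc]
  rw [frobeniusNorm_eq_sqrt_trace, frobeniusNorm_eq_sqrt_trace, h, trace_mul_cycle, hQ,
    Matrix.one_mul]

theorem frobeniusNorm_diagonal (d : Fin n → ℝ) :
    frobeniusNorm (diagonal d) = Real.sqrt (∑ i, d i ^ 2) := by
  simp [frobeniusNorm_eq_sqrt_trace, trace, pow_two]

theorem sum_mul_diag_le_frobeniusNorm (a : Fin n → ℝ) (A : Matrix (Fin n) (Fin n) ℝ) :
    ∑ i, a i * A i i ≤ Real.sqrt (∑ i, a i ^ 2) * frobeniusNorm A := by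
  refine (Real.sum_mul_le_sqrt_mul_sqrt _ _ _).trans ?_
  refine mul_le_mul_of_nonneg_left (Real.sqrt_le_sqrt ?_) (Real.sqrt_nonneg _)
  exact Finset.sum_le_sum fun i _ =>
    Finset.single_le_sum (f := fun j => A i j ^ 2) (fun j _ => sq_nonneg _) (Finset.mem_univ i)

end Frobenius

/-! ### Leading principal blocks and triangular congruences -/

section Flags

variable {n : ℕ}

/-- Abel summation of increasing weights against a sequence with nonpositive partial sums. If the
total is `0` the left side vanishes; the bound `c` makes the induction on `n` work. -/
theorem mul_sum_le_sum_mul_of_monotone : ∀ {n : ℕ} {a d : Fin n → ℝ}, Monotone a →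
    (∀ k : ℕ, ∑ i : {i : Fin n // i.val < k}, d i ≤ 0) → ∀ {c : ℝ}, (∀ i, a i ≤ c) →
    c * ∑ i, d i ≤ ∑ i, a i * d i
  | 0, _, _, _, _, _, _ => by simp
  | n + 1, a, d, ha, hd, c, hc => by
    have hsub : ∀ k ≤ n, ∑ i : {i : Fin (n + 1) // i.val < k}, d i
        = ∑ i : {i : Fin n // i.val < k}, d i.1.castSucc := by
      intro k hk
      symm
      refine Fintype.sum_equiv ⟨fun i => ⟨i.1.castSucc, i.2⟩,
        fun i => ⟨⟨i.1.val, i.2.trans_le hk⟩, i.2⟩, fun _ => rfl, fun _ => rfl⟩ _ _ fun _ => rfl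
    have hall : ∀ k : ℕ, ∀ m : ℕ, m ≤ k → ∀ f : Fin m → ℝ,
        ∑ i : {i : Fin m // i.val < k}, f i = ∑ i, f i := by
      intro k m hk f
      exact Fintype.sum_equiv (Equiv.subtypeUnivEquiv fun i => i.2.trans_le hk) _ _ fun _ => rfl
    have ih := mul_sum_le_sum_mul_of_monotone (a := fun i : Fin n => a i.castSucc)
      (d := fun i : Fin n => d i.castSucc) (fun i j hij => ha (Fin.castSucc_le_castSucc_iff.2 hij))
      (fun k => by
        rcases le_total k n with hk | hk
        · rw [← hsub k hk]; exact hd k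
        · rw [hall k n hk fun i => d i.castSucc, ← hall n n le_rfl, ← hsub n le_rfl]
          exact hd n)
      (c := a (Fin.last n)) (fun i => ha (Fin.le_last _))
    have htot : ∑ i, d i ≤ 0 := by
      rw [← hall (n + 1) (n + 1) le_rfl]; exact hd (n + 1)
    calc c * ∑ i, d i ≤ a (Fin.last n) * ∑ i, d i :=
          mul_le_mul_of_nonpos_right (hc _) htot
      _ ≤ ∑ i, a i * d i := by
          rw [Fin.sum_univ_castSucc, Fin.sum_univ_castSucc, mul_add]
          linarith

/-- Congruence by a lower triangular matrix acts on each leading principal block separately. -/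
theorem submatrix_lowerTriangular_conj {N : Matrix (Fin n) (Fin n) ℝ}
    (hN : ∀ i j, i < j → N i j = 0) (A : Matrix (Fin n) (Fin n) ℝ) (k : ℕ) :
    let e : {i : Fin n // i.val < k} → Fin n := Subtype.val
    (N * A * Nᵀ).submatrix e e = N.submatrix e e * A.submatrix e e * (N.submatrix e e)ᵀ := by
  intro e
  have hl : ∀ B : Matrix (Fin n) (Fin n) ℝ,
      (N * B).submatrix e e = N.submatrix e e * B.submatrix e e := by
    intro B
    ext i j
    simp only [submatrix_apply, mul_apply]
    rw [← Fintype.sum_subtype_add_sum_subtype (fun p : Fin n => p.val < k), add_eq_left]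
    exact Finset.sum_eq_zero fun p _ => by
      rw [hN i.1 p.1 (Fin.lt_def.2 (i.2.trans_le (not_lt.1 p.2))), zero_mul]
  calc (N * A * Nᵀ).submatrix e e = N.submatrix e e * ((N * Aᵀ).submatrix e e)ᵀ := by
        rw [Matrix.mul_assoc, hl, transpose_submatrix, transpose_mul, transpose_transpose]
    _ = _ := by
        rw [hl, transpose_mul, transpose_submatrix Aᵀ, transpose_transpose, Matrix.mul_assoc]

/-- The `LDL` decomposition of `Y`, with the diagonal factor absorbed into the triangular one. -/
theorem exists_lowerTriangular_conj_eq_one {Y : Matrix (Fin n) (Fin n) ℝ} (hY : Y.PosDef) :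
    ∃ N : Matrix (Fin n) (Fin n) ℝ, (∀ i j, i < j → N i j = 0) ∧ N * Y * Nᵀ = 1 := by
  have hd : (LDL.diag hY).PosDef := by
    rw [LDL.diag_eq_lowerInv_conj, conjTranspose_eq_transpose_of_trivial]
    exact posDef_conj hY (isUnit_of_invertible _)
  have hd' : ∀ i, 0 < LDL.diagEntries hY i := by
    rw [LDL.diag, posDef_diagonal_iff] at hd
    exact hd
  refine ⟨diagonal (fun i => (Real.sqrt (LDL.diagEntries hY i))⁻¹) * LDL.lowerInv hY, ?_, ?_⟩
  · intro i j hij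
    rw [diagonal_mul, LDL.lowerInv_triangular hY hij, mul_zero]
  · have h := LDL.diag_eq_lowerInv_conj hY
    rw [conjTranspose_eq_transpose_of_trivial] at h
    set D := diagonal (fun i => (Real.sqrt (LDL.diagEntries hY i))⁻¹)
    calc D * LDL.lowerInv hY * Y * (D * LDL.lowerInv hY)ᵀ
        = D * (LDL.lowerInv hY * Y * (LDL.lowerInv hY)ᵀ) * Dᵀ := by
          simp only [transpose_mul, Matrix.mul_assoc]
      _ = D * LDL.diag hY * Dᵀ := by rw [h]
      _ = 1 := by
          rw [LDL.diag, diagonal_transpose, diagonal_mul_diagonal, diagonal_mul_diagonal,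
            diagonal_eq_one]
          funext i
          have := Real.sqrt_pos.2 (hd' i)
          simp only [Pi.one_apply]
          rw [← div_eq_inv_mul, mul_inv_eq_one₀ this.ne', div_eq_iff this.ne',
            Real.mul_self_sqrt (hd' i).le]

/-- The leading minors of `Y` and of `N diag(exp a) Nᵀ` multiply to those of `diag(exp a)`, because
the minors of the triangular matrix `N` cancel. Together with the trace Jensen inequality on each
leading block, and Abel summation against the increasing weights `a`, this bounds `∑ aᵢ²`. -/
theorem sum_sq_le_of_lowerTriangular {a : Fin n → ℝ} (ha : Monotone a)
    {Y N : Matrix (Fin n) (Fin n) ℝ} (hY : Y.PosDef) (hN : ∀ i j, i < j → N i j = 0)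
    (hNY : N * Y * Nᵀ = 1) :
    ∑ i, a i ^ 2 ≤ ∑ i, a i * cfc Real.log Y i i +
      ∑ i, a i * cfc Real.log (N * diagonal (fun i => Real.exp (a i)) * Nᵀ) i i := by
  set Z := diagonal (fun i => Real.exp (a i)) with hZ
  have hZpos : Z.PosDef := posDef_diagonal_iff.2 fun i => Real.exp_pos _
  have hdet : N.det * Y.det * N.det = 1 := by simpa using congrArg det hNY
  have hNu : IsUnit N := by
    rw [isUnit_iff_isUnit_det, isUnit_iff_ne_zero]
    intro h; simp [h] at hdet
  have hC : (N * Z * Nᵀ).PosDef := posDef_conj hZpos hNu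
  set C := N * Z * Nᵀ with hCdef
  set d : Fin n → ℝ := fun i => cfc Real.log Y i i + cfc Real.log C i i - a i with hd
  have hpart : ∀ k : ℕ, ∑ i : {i : Fin n // i.val < k}, d i ≤ 0 := by
    intro k
    set e : {i : Fin n // i.val < k} → Fin n := Subtype.val with he
    have hinj : Function.Injective e := Subtype.val_injective
    have h1 : (N * Y * Nᵀ).submatrix e e = _ := submatrix_lowerTriangular_conj hN Y k
    have h2 : C.submatrix e e = _ := submatrix_lowerTriangular_conj hN Z k
    rw [hNY, submatrix_one e hinj] at h1
    replace h1 := congrArg det h1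
    replace h2 := congrArg det h2
    rw [det_one, det_mul, det_mul, det_transpose] at h1
    rw [det_mul, det_mul, det_transpose] at h2
    have hYk : 0 < (Y.submatrix e e).det := (hY.submatrix hinj).det_pos
    have hCk : 0 < (C.submatrix e e).det := (hC.submatrix hinj).det_pos
    have hZk : (Z.submatrix e e).det = Real.exp (∑ i, a (e i)) := by
      rw [hZ, submatrix_diagonal _ _ hinj, det_diagonal, Real.exp_sum]; rfl
    have hprod : (Y.submatrix e e).det * (C.submatrix e e).det = Real.exp (∑ i, a (e i)) := by
      rw [h2, hZk]
      linear_combination -Real.exp (∑ i, a (e i)) * h1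
    have hlog := congrArg Real.log hprod
    rw [Real.log_mul hYk.ne' hCk.ne', Real.log_exp] at hlog
    have hJ1 := trace_submatrix_cfc_log_le hY hinj
    have hJ2 := trace_submatrix_cfc_log_le hC hinj
    simp only [hd, Finset.sum_sub_distrib, Finset.sum_add_distrib]
    simp only [he] at hJ1 hJ2 hlog
    linarith
  have htot : ∑ i, d i = 0 := by
    have hZd : Z.det = Real.exp (∑ i, a i) := by rw [hZ, det_diagonal, Real.exp_sum]
    have hprod : Y.det * C.det = Real.exp (∑ i, a i) := by
      rw [hCdef, det_mul, det_mul, det_transpose, hZd]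
      linear_combination Real.exp (∑ i, a i) * hdet
    have hlog := congrArg Real.log hprod
    rw [Real.log_mul hY.det_pos.ne' hC.det_pos.ne', Real.log_exp, ← trace_cfc_log hY,
      ← trace_cfc_log hC] at hlog
    simp only [hd, Finset.sum_sub_distrib, Finset.sum_add_distrib]
    simp only [trace, diag_apply] at hlog
    linarith
  have hA := mul_sum_le_sum_mul_of_monotone ha hpart (c := ∑ i, |a i|) fun i =>
    (le_abs_self _).trans
      (Finset.single_le_sum (f := fun i => |a i|) (fun _ _ => abs_nonneg _) (Finset.mem_univ i))
  rw [htot, mul_zero] at hA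
  have : ∑ i, a i * d i = ∑ i, a i * cfc Real.log Y i i + ∑ i, a i * cfc Real.log C i i
      - ∑ i, a i ^ 2 := by
    rw [← Finset.sum_add_distrib, ← Finset.sum_sub_distrib]
    exact Finset.sum_congr rfl fun i _ => by simp only [hd]; ring
  linarith

end Flags

/-! ### The two distances on positive definite matrices -/

section Distances

variable {n : ℕ}

theorem exists_orthogonal_exp_monotone {P : Matrix (Fin n) (Fin n) ℝ} (hP : P.PosDef) :
    ∃ (U : Matrix (Fin n) (Fin n) ℝ) (h : Fin n → ℝ), Uᵀ * U = 1 ∧ Monotone h ∧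
      P = U * diagonal (fun i => Real.exp (h i)) * Uᵀ := by
  obtain ⟨U, h, hU, rfl⟩ := exists_orthogonal_exp hP
  set σ := Tuple.sort h
  refine ⟨U.submatrix id σ, h ∘ σ, ?_, Tuple.monotone_sort h, ?_⟩
  · ext i j
    have := congrFun (congrFun hU (σ i)) (σ j)
    simpa [mul_apply, one_apply] using this
  · have hd : diagonal (fun i => Real.exp ((h ∘ σ) i))
        = (diagonal (fun i => Real.exp (h i))).submatrix σ σ :=
      (submatrix_diagonal_equiv (fun i => Real.exp (h i)) σ).symm
    rw [hd, transpose_submatrix, submatrix_mul_equiv, submatrix_mul_equiv, submatrix_id_id]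

/-- The congruence by `Y ^ (-1/2)` is symmetric and sends `Y` to the identity. -/
theorem matrixSqrt_inv_spec {Y : Matrix (Fin n) (Fin n) ℝ} (hY : Y.PosDef) :
    (matrixSqrt Y)⁻¹ᵀ = (matrixSqrt Y)⁻¹ ∧ IsUnit (matrixSqrt Y) ∧
      matrixSqrt Y * matrixSqrt Y = Y ∧ (matrixSqrt Y)⁻¹ * Y * (matrixSqrt Y)⁻¹ᵀ = 1 := by
  have hs : (matrixSqrt Y)ᵀ = matrixSqrt Y ∧ matrixSqrt Y * matrixSqrt Y = Y := by
    obtain ⟨U, h, hU, rfl⟩ := exists_orthogonal_exp hY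
    rw [matrixSqrt, cfc_orthogonal_diagonal _ hU]
    set D := diagonal fun i => Real.sqrt (Real.exp (h i)) with hD
    have hDD : D * D = diagonal fun i => Real.exp (h i) := by
      simp [hD, Real.mul_self_sqrt (Real.exp_pos _).le]
    constructor
    · simp [transpose_mul, Matrix.mul_assoc, hD]
    · calc U * D * Uᵀ * (U * D * Uᵀ) = U * D * (Uᵀ * U) * D * Uᵀ := by
            simp only [Matrix.mul_assoc]
        _ = U * (D * D) * Uᵀ := by rw [hU, Matrix.mul_one]; simp only [Matrix.mul_assoc]
        _ = _ := by rw [hDD]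
  obtain ⟨hs1, hs2⟩ := hs
  have hu : IsUnit (matrixSqrt Y) := by
    rw [isUnit_iff_isUnit_det, isUnit_iff_ne_zero]
    intro h
    have := hY.det_pos
    rw [← hs2, det_mul, h, zero_mul] at this
    exact this.false
  have hud := (isUnit_iff_isUnit_det _).1 hu
  have hi : (matrixSqrt Y)⁻¹ᵀ = (matrixSqrt Y)⁻¹ := by rw [transpose_nonsing_inv, hs1]
  refine ⟨hi, hu, hs2, ?_⟩
  rw [hi]
  calc (matrixSqrt Y)⁻¹ * Y * (matrixSqrt Y)⁻¹
      = (matrixSqrt Y)⁻¹ * (matrixSqrt Y * matrixSqrt Y) * (matrixSqrt Y)⁻¹ := by rw [hs2]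
    _ = 1 := by
        rw [← Matrix.mul_assoc, nonsing_inv_mul _ hud, Matrix.one_mul, mul_nonsing_inv _ hud]

/-- `airmDist X Y` can be computed with any congruence `B` that sends `Y` to the identity: two
such congruences differ by an orthogonal matrix. -/
theorem airmDist_eq_of_conj_eq_one (X Y : SPD n) {B : Matrix (Fin n) (Fin n) ℝ}
    (hB : B * Y.1 * Bᵀ = 1) : airmDist X Y = frobeniusNorm (matrixLog (B * X.1 * Bᵀ)) := by
  obtain ⟨hT, hu, hS, hR⟩ := matrixSqrt_inv_spec Y.2
  rw [airmDist]
  set S := matrixSqrt Y.1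
  have hud := (isUnit_iff_isUnit_det _).1 hu
  have hST : Sᵀ = S := by
    rw [← nonsing_inv_nonsing_inv S hud, transpose_nonsing_inv, hT]
  have hQ : (B * S)ᵀ * (B * S) = 1 := by
    rw [mul_eq_one_comm, transpose_mul, hST, Matrix.mul_assoc, ← Matrix.mul_assoc S, hS,
      ← Matrix.mul_assoc, hB]
  have hP : (S⁻¹ * X.1 * S⁻¹).PosDef := by
    have := posDef_conj X.2 ((isUnit_nonsing_inv_iff).2 hu)
    rwa [hT] at this
  have hBX : B * X.1 * Bᵀ = (B * S) * (S⁻¹ * X.1 * S⁻¹) * (B * S)ᵀ := by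
    have h1 : S * S⁻¹ = 1 := mul_nonsing_inv _ hud
    have h2 : S⁻¹ * S = 1 := nonsing_inv_mul _ hud
    calc B * X.1 * Bᵀ = B * (S * S⁻¹) * X.1 * (S⁻¹ * S) * Bᵀ := by
          rw [h1, h2, Matrix.mul_one, Matrix.mul_one]
      _ = _ := by rw [transpose_mul, hST]; simp only [Matrix.mul_assoc]
  rw [hBX, matrixLog, matrixLog, cfc_log_orthogonal_conj hP hQ, frobeniusNorm_orthogonal_conj hQ]

theorem airmDist_triangle (X Y Z : SPD n) : airmDist X Z ≤ airmDist X Y + airmDist Y Z := by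
  obtain ⟨hT, hu, -, hR⟩ := matrixSqrt_inv_spec Z.2
  set R := (matrixSqrt Z.1)⁻¹
  have huR : IsUnit R := isUnit_nonsing_inv_iff.2 hu
  obtain ⟨U, a, hU, ha, hUa⟩ := exists_orthogonal_exp_monotone (posDef_conj X.2 huR)
  -- Congruence by `Uᵀ * R` sends `Z` to the identity and diagonalizes `X` in increasing order.
  have hB : (Uᵀ * R) * Z.1 * (Uᵀ * R)ᵀ = 1 := by
    calc (Uᵀ * R) * Z.1 * (Uᵀ * R)ᵀ = Uᵀ * (R * Z.1 * Rᵀ) * U := by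
          simp only [transpose_mul, transpose_transpose, Matrix.mul_assoc]
      _ = 1 := by rw [hR, Matrix.mul_one, hU]
  have hBX : (Uᵀ * R) * X.1 * (Uᵀ * R)ᵀ = diagonal fun i => Real.exp (a i) := by
    calc (Uᵀ * R) * X.1 * (Uᵀ * R)ᵀ = Uᵀ * (R * X.1 * Rᵀ) * U := by
          simp only [transpose_mul, transpose_transpose, Matrix.mul_assoc]
      _ = (Uᵀ * U) * (diagonal fun i => Real.exp (a i)) * (Uᵀ * U) := by
          rw [hUa]; simp only [Matrix.mul_assoc]
      _ = _ := by rw [hU, Matrix.one_mul, Matrix.mul_one]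
  have huU : IsUnit (Uᵀ * R) := (IsUnit.of_mul_eq_one _ hU).mul huR
  set B := Uᵀ * R
  have hY := posDef_conj Y.2 huU
  obtain ⟨N, hN, hNY⟩ := exists_lowerTriangular_conj_eq_one hY
  have hXZ : airmDist X Z = Real.sqrt (∑ i, a i ^ 2) := by
    rw [airmDist_eq_of_conj_eq_one X Z hB, hBX, matrixLog]
    have := cfc_log_orthogonal_exp (U := (1 : Matrix (Fin n) (Fin n) ℝ)) (by simp) a
    simp only [transpose_one, Matrix.one_mul, Matrix.mul_one] at this
    rw [this, frobeniusNorm_diagonal]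
  have hYZ := airmDist_eq_of_conj_eq_one Y Z hB
  have hXY : airmDist X Y
      = frobeniusNorm (matrixLog (N * (diagonal fun i => Real.exp (a i)) * Nᵀ)) := by
    have hNB : (N * B) * Y.1 * (N * B)ᵀ = 1 := by
      rw [← hNY]; simp only [transpose_mul, Matrix.mul_assoc]
    rw [airmDist_eq_of_conj_eq_one X Y hNB, ← hBX]
    simp only [transpose_mul, Matrix.mul_assoc]
  have hmain := sum_sq_le_of_lowerTriangular ha hY hN hNY
  have h1 := sum_mul_diag_le_frobeniusNorm a (matrixLog (B * Y.1 * Bᵀ))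
  have h2 := sum_mul_diag_le_frobeniusNorm a
    (matrixLog (N * (diagonal fun i => Real.exp (a i)) * Nᵀ))
  rw [← hYZ, ← hXZ] at h1
  rw [← hXY, ← hXZ] at h2
  have hsq : airmDist X Z ^ 2 = ∑ i, a i ^ 2 := by
    rw [hXZ, Real.sq_sqrt (Finset.sum_nonneg fun i _ => sq_nonneg _)]
  have h0 : 0 ≤ airmDist X Z := frobeniusNorm_nonneg _
  have hle : airmDist X Z * airmDist X Z ≤ airmDist X Z * (airmDist X Y + airmDist Y Z) := by
    simp only [matrixLog] at h1 h2
    nlinarith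
  rcases h0.eq_or_lt with h | h
  · rw [← h]
    exact add_nonneg (frobeniusNorm_nonneg _) (frobeniusNorm_nonneg _)
  · exact le_of_mul_le_mul_left hle h

/-- Both distances are functions of the logarithms `u` of the eigenvalues of `X` relative
to `Y`. -/
theorem exists_relative_log_eigenvalues (X Y : SPD n) :
    ∃ u : Fin n → ℝ, airmDist X Y ^ 2 = ∑ i, u i ^ 2 ∧
      steinDivergence X Y = ∑ i, Real.log (Real.cosh (u i / 2)) := by
  obtain ⟨hT, hu, -, hR⟩ := matrixSqrt_inv_spec Y.2
  have huR : IsUnit (matrixSqrt Y.1)⁻¹ := isUnit_nonsing_inv_iff.2 hu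
  have hdist := airmDist_eq_of_conj_eq_one X Y hR
  set R := (matrixSqrt Y.1)⁻¹
  obtain ⟨U, u, hU, hUu⟩ := exists_orthogonal_exp (posDef_conj X.2 huR)
  have hU' : U * Uᵀ = 1 := mul_eq_one_comm.1 hU
  have hdU : U.det * U.det = 1 := by simpa using congrArg det hU
  refine ⟨u, ?_, ?_⟩
  · rw [hdist, matrixLog, hUu, cfc_log_orthogonal_exp hU, frobeniusNorm_orthogonal_conj hU,
      frobeniusNorm_diagonal, Real.sq_sqrt (Finset.sum_nonneg fun i _ => sq_nonneg _)]
  · have hdR : R.det * Y.1.det * R.det = 1 := by simpa using congrArg det hR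
    have hYpos := Y.2.det_pos
    have hRne : R.det ≠ 0 := fun h => by simp [h] at hdR
    have hdX : X.1.det = Y.1.det * ∏ i, Real.exp (u i) := by
      have h := congrArg det hUu
      simp only [det_mul, det_transpose, det_diagonal] at h
      have h' : R.det * R.det * X.1.det = R.det * R.det * (Y.1.det * ∏ i, Real.exp (u i)) := by
        linear_combination h + (∏ i, Real.exp (u i)) * hdU - (∏ i, Real.exp (u i)) * hdR
      exact mul_left_cancel₀ (mul_ne_zero hRne hRne) h'
    have hdXY : ((1 / 2 : ℝ) • (X.1 + Y.1)).det
        = Y.1.det * ∏ i, (1 / 2 * (Real.exp (u i) + 1)) := by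
      have hE : R * ((1 / 2 : ℝ) • (X.1 + Y.1)) * Rᵀ
          = U * diagonal (fun i => 1 / 2 * (Real.exp (u i) + 1)) * Uᵀ := by
        have hdd : diagonal (fun i => 1 / 2 * (Real.exp (u i) + 1))
            = (1 / 2 : ℝ) • ((diagonal fun i => Real.exp (u i)) + 1) := by
          ext i j
          rcases eq_or_ne i j with rfl | h
          · simp
          · simp [h]
        rw [hdd, Matrix.mul_smul, Matrix.smul_mul, Matrix.mul_smul, Matrix.smul_mul,
          Matrix.mul_add, Matrix.add_mul, hR, hUu, Matrix.mul_add, Matrix.add_mul,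
          Matrix.mul_one, hU']
      have h := congrArg det hE
      rw [det_mul, det_mul, det_transpose, det_mul, det_mul, det_transpose, det_diagonal] at h
      set p := ∏ i, (1 / 2 * (Real.exp (u i) + 1))
      have h' : R.det * R.det * ((1 / 2 : ℝ) • (X.1 + Y.1)).det
          = R.det * R.det * (Y.1.det * p) := by
        linear_combination h + p * hdU - p * hdR
      exact mul_left_cancel₀ (mul_ne_zero hRne hRne) h'
    have hterm : ∀ i, Real.log (Real.cosh (u i / 2))
        = Real.log (1 / 2 * (Real.exp (u i) + 1)) - 1 / 2 * u i := by
      intro i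
      have : 1 / 2 * (Real.exp (u i) + 1) = Real.exp (u i / 2) * Real.cosh (u i / 2) := by
        rw [Real.cosh_eq]
        have e1 : Real.exp (u i) = Real.exp (u i / 2) * Real.exp (u i / 2) := by
          rw [← Real.exp_add, add_halves]
        have e2 : Real.exp (u i / 2) * Real.exp (-(u i / 2)) = 1 := by
          rw [← Real.exp_add, add_neg_cancel, Real.exp_zero]
        rw [e1]; linear_combination -(1 / 2) * e2
      rw [this, Real.log_mul (Real.exp_pos _).ne' (Real.cosh_pos _).ne', Real.log_exp]
      ring
    have hpos : ∀ i, (1 / 2 * (Real.exp (u i) + 1)) ≠ 0 := fun i =>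
      (mul_pos one_half_pos (add_pos (Real.exp_pos _) one_pos)).ne'
    rw [steinDivergence, hdXY, det_mul, hdX, ← Real.exp_sum,
      Real.log_mul hYpos.ne' (Finset.prod_ne_zero_iff.2 fun i _ => hpos i),
      Real.log_mul (mul_pos hYpos (Real.exp_pos _)).ne' hYpos.ne',
      Real.log_mul hYpos.ne' (Real.exp_pos _).ne', Real.log_exp,
      Real.log_prod (fun i _ => hpos i)]
    simp only [hterm, Finset.sum_sub_distrib, ← Finset.mul_sum]
    ring

theorem log_cosh_le_half_sq (x : ℝ) : Real.log (Real.cosh x) ≤ x ^ 2 / 2 :=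
  (Real.log_le_iff_le_exp (Real.cosh_pos x)).2 (Real.cosh_le_exp_half_sq x)

theorem one_add_half_sq_le_cosh (x : ℝ) : 1 + x ^ 2 / 2 ≤ Real.cosh x := by
  have := sum_le_hasSum (Finset.range 2)
    (fun i _ => div_nonneg ((even_two_mul i).pow_nonneg x) (Nat.cast_nonneg _))
    (Real.hasSum_cosh x)
  simpa [Finset.sum_range_succ] using this

/-- A reverse of `log_cosh_le_half_sq` up to the factor `1 + κ`, valid near `0`. -/
theorem half_sq_le_mul_log_cosh {x κ : ℝ} (hκ : 0 < κ)
    (hx : Real.log (Real.cosh x) ≤ Real.log (1 + κ)) :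
    x ^ 2 / 2 ≤ (1 + κ) * Real.log (Real.cosh x) := by
  have hc : Real.cosh x ≤ 1 + κ :=
    (Real.log_le_log_iff (Real.cosh_pos x) (by linarith)).1 hx
  have h1 := one_add_half_sq_le_cosh x
  have h2 := Real.one_sub_inv_le_log_of_pos (Real.cosh_pos x)
  have hpos := Real.cosh_pos x
  have h0 : 0 ≤ Real.log (Real.cosh x) := Real.log_nonneg (Real.one_le_cosh x)
  calc x ^ 2 / 2 ≤ Real.cosh x - 1 := by linarith
    _ = Real.cosh x * (1 - (Real.cosh x)⁻¹) := by field_simp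
    _ ≤ Real.cosh x * Real.log (Real.cosh x) := mul_le_mul_of_nonneg_left h2 hpos.le
    _ ≤ _ := mul_le_mul_of_nonneg_right hc h0

theorem two_sqrt_two_mul_steinDist_le_airmDist (X Y : SPD n) :
    2 * Real.sqrt 2 * steinDist X Y ≤ airmDist X Y := by
  obtain ⟨u, hu, hs⟩ := exists_relative_log_eigenvalues X Y
  have h : 8 * steinDivergence X Y ≤ airmDist X Y ^ 2 := by
    rw [hu, hs, Finset.mul_sum]
    exact Finset.sum_le_sum fun i _ => by linarith [log_cosh_le_half_sq (u i / 2)]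
  have h8 : 2 * Real.sqrt 2 = Real.sqrt 8 := by
    rw [show (8 : ℝ) = 2 ^ 2 * 2 by norm_num, Real.sqrt_mul (by norm_num),
      Real.sqrt_sq (by norm_num)]
  rw [steinDist, h8, ← Real.sqrt_mul (by norm_num)]
  exact Real.sqrt_le_iff.2 ⟨frobeniusNorm_nonneg _, h⟩

theorem airmDist_le_mul_steinDist {X Y : SPD n} {κ : ℝ} (hκ : 0 < κ)
    (h : steinDivergence X Y ≤ Real.log (1 + κ)) :
    airmDist X Y ≤ Real.sqrt (8 * (1 + κ)) * steinDist X Y := by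
  obtain ⟨u, hu, hs⟩ := exists_relative_log_eigenvalues X Y
  have h0 : ∀ i, 0 ≤ Real.log (Real.cosh (u i / 2)) := fun i =>
    Real.log_nonneg (Real.one_le_cosh _)
  rw [steinDist, ← Real.sqrt_mul (by positivity)]
  refine Real.le_sqrt_of_sq_le ?_
  rw [hu, hs, Finset.mul_sum]
  refine Finset.sum_le_sum fun i _ => ?_
  have hi : Real.log (Real.cosh (u i / 2)) ≤ Real.log (1 + κ) :=
    ((Finset.single_le_sum (fun j _ => h0 j) (Finset.mem_univ i)).trans_eq hs.symm).trans h
  linarith [half_sq_le_mul_log_cosh hκ hi]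

theorem steinDivergence_self (X : SPD n) : steinDivergence X X = 0 := by
  have h : (1 / 2 : ℝ) • (X.1 + X.1) = X.1 := by
    rw [← two_smul ℝ, smul_smul]; norm_num
  rw [steinDivergence, h, det_mul, Real.log_mul X.2.det_pos.ne' X.2.det_pos.ne']
  ring

theorem airmDist_self_le (X : SPD n) : airmDist X X ≤ 0 := by
  have h := airmDist_le_mul_steinDist (X := X) (Y := X) one_pos
    (by rw [steinDivergence_self]; exact Real.log_nonneg (by norm_num))
  rwa [steinDist, steinDivergence_self, Real.sqrt_zero, mul_zero] at h

theorem continuous_steinDivergence :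
    Continuous fun p : SPD n × SPD n => steinDivergence p.1 p.2 := by
  have h1 : Continuous fun p : SPD n × SPD n => p.1.1 := continuous_subtype_val.comp continuous_fst
  have h2 : Continuous fun p : SPD n × SPD n => p.2.1 := continuous_subtype_val.comp continuous_snd
  refine Continuous.sub (Continuous.log ?_ fun p => ?_)
    (continuous_const.mul (Continuous.log ?_ fun p => ?_))
  · exact ((h1.add h2).const_smul (1 / 2 : ℝ)).matrix_det
  · exact ((p.1.2.add p.2.2).smul (by norm_num : (0 : ℝ) < 1 / 2)).det_pos.ne'
  · exact (h1.matrix_mul h2).matrix_det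
  · rw [det_mul]
    exact (mul_pos p.1.2.det_pos p.2.2.det_pos).ne'

end Distances

/-! ### Comparison of curve lengths -/

section CurveLength

variable {M : Type*} {d d₁ d₂ : M → M → ℝ} {γ : unitInterval → M} {δ : ℝ}

/-- `FineChain d γ δ a b r` says that some chain `a < ⋯ < b` of parameters with steps at most `δ`
has `d`-length `r` along `γ`. The one-point chain is allowed. -/
inductive FineChain (d : M → M → ℝ) (γ : unitInterval → M) (δ : ℝ) :
    unitInterval → unitInterval → ℝ → Prop
  | nil (a : unitInterval) : FineChain d γ δ a a 0
  | cons {a b c : unitInterval} {r : ℝ} (hab : a < b) (hδ : (b : ℝ) - a ≤ δ)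
      (h : FineChain d γ δ b c r) : FineChain d γ δ a c (d (γ b) (γ a) + r)

theorem FineChain.trans {a b c : unitInterval} {r s : ℝ} (h : FineChain d γ δ a b r)
    (h' : FineChain d γ δ b c s) : FineChain d γ δ a c (r + s) := by
  induction h with
  | nil => simpa using h'
  | cons hab hδ _ ih => rw [add_assoc]; exact .cons hab hδ (ih h')

theorem FineChain.exists_partition {a b : unitInterval} {r : ℝ} (h : FineChain d γ δ a b r) :
    ∃ (k : ℕ) (t : Fin (k + 1) → unitInterval), StrictMono t ∧ t 0 = a ∧ t (Fin.last k) = b ∧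
      ∑ i : Fin k, d (γ (t i.succ)) (γ (t i.castSucc)) = r := by
  induction h with
  | nil a => exact ⟨0, fun _ => a, fun i j hij => by omega, rfl, rfl, by simp⟩
  | @cons a b c r hab hδ _ ih =>
    obtain ⟨k, t, ht, h0, hl, hs⟩ := ih
    refine ⟨k + 1, Fin.cons a t, ?_, rfl, ?_, ?_⟩
    · rw [Fin.strictMono_cons]
      exact ⟨fun j => hab.trans_le (h0 ▸ ht.monotone (Fin.zero_le j)), ht⟩
    · rw [← Fin.succ_last, Fin.cons_succ, hl]
    · rw [Fin.sum_univ_succ]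
      simp only [Fin.cons_succ, Fin.castSucc_zero, Fin.cons_zero, ← Fin.succ_castSucc, hs, h0]

theorem FineChain.ofReal_le_curveLength {r : ℝ} (h : FineChain d γ δ 0 1 r) :
    ENNReal.ofReal r ≤ curveLength d γ := by
  obtain ⟨k, t, ht, h0, hl, rfl⟩ := h.exists_partition
  exact le_iSup_of_le k (le_iSup_of_le t (le_iSup_of_le ⟨ht, h0, hl⟩ le_rfl))

theorem exists_fineChain (d : M → M → ℝ) (γ : unitInterval → M) (hδ : 0 < δ)
    {a b : unitInterval} (hab : a ≤ b) : ∃ r, FineChain d γ δ a b r := by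
  obtain ⟨N, hN⟩ := exists_nat_ge (((b : ℝ) - a) / δ)
  rw [div_le_iff₀ hδ] at hN
  induction N generalizing a with
  | zero =>
    have : a = b := le_antisymm hab (by simpa using hN)
    exact ⟨0, this ▸ .nil a⟩
  | succ N ih =>
    rcases hab.eq_or_lt with rfl | hlt
    · exact ⟨0, .nil a⟩
    rcases le_or_gt ((b : ℝ) - a) δ with h | h
    · exact ⟨_, .cons hlt h (.nil b)⟩
    · let c : unitInterval := ⟨a + δ, by linarith [a.2.1], by linarith [b.2.2]⟩
      obtain ⟨r, hr⟩ := ih (a := c) (Subtype.coe_le_coe.1 (by simp only [c]; linarith))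
        (by push_cast at hN; simp only [c]; linarith)
      exact ⟨_, .cons (b := c) (Subtype.coe_lt_coe.1 (by simp only [c]; linarith))
        (by simp only [c]; linarith) hr⟩

/-- Along a fine chain the triangle inequality and the local comparison accumulate. -/
theorem FineChain.dist_le {c : ℝ} (htri : ∀ x y z, d₁ x z ≤ d₁ x y + d₁ y z)
    (hself : ∀ x, d₁ x x ≤ 0)
    (hloc : ∀ s t : unitInterval, s < t → (t : ℝ) - s ≤ δ → d₁ (γ t) (γ s) ≤ c * d₂ (γ t) (γ s))
    {a b : unitInterval} {r : ℝ} (h : FineChain d₂ γ δ a b r) : d₁ (γ b) (γ a) ≤ c * r := by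
  induction h with
  | nil a => simpa using hself (γ a)
  | cons hab hδ _ ih => linarith [htri _ _ _ |>.trans (add_le_add ih (hloc _ _ hab hδ))]

/-- If `d₁` satisfies the triangle inequality and `d₁ ≤ c * d₂` at nearby parameters, then the
lengths compare. Every partition is refined into steps where the comparison holds; refining does
not decrease `d₁`-sums, and no triangle inequality for `d₂` is needed. -/
theorem curveLength_le_of_local_le {c : ℝ} (hc : 0 ≤ c)
    (htri : ∀ x y z, d₁ x z ≤ d₁ x y + d₁ y z) (hself : ∀ x, d₁ x x ≤ 0) (hδ : 0 < δ)
    (hloc : ∀ s t : unitInterval, s < t → (t : ℝ) - s ≤ δ →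
      d₁ (γ t) (γ s) ≤ c * d₂ (γ t) (γ s)) :
    curveLength d₁ γ ≤ ENNReal.ofReal c * curveLength d₂ γ := by
  have key : ∀ (k : ℕ) (t : Fin (k + 1) → unitInterval), StrictMono t →
      ∃ r, FineChain d₂ γ δ (t 0) (t (Fin.last k)) r ∧
        ∑ i : Fin k, d₁ (γ (t i.succ)) (γ (t i.castSucc)) ≤ c * r := by
    intro k
    induction k with
    | zero => exact fun t _ => ⟨0, .nil _, by simp⟩
    | succ k ih =>
      intro t ht
      obtain ⟨r, hr, hsum⟩ := ih (fun i => t i.succ) fun i j hij => ht (Fin.succ_lt_succ_iff.2 hij)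
      obtain ⟨s, hs⟩ := exists_fineChain d₂ γ hδ (ht.monotone (Fin.zero_le (Fin.succ 0)))
      refine ⟨s + r, hs.trans hr, ?_⟩
      rw [Fin.sum_univ_succ, mul_add]
      exact add_le_add (hs.dist_le htri hself hloc) hsum
  refine iSup_le fun k => iSup_le fun t => iSup_le fun ⟨ht, h0, hl⟩ => ?_
  obtain ⟨r, hr, hsum⟩ := key k t ht
  rw [h0, hl] at hr
  calc ENNReal.ofReal _ ≤ ENNReal.ofReal (c * r) := ENNReal.ofReal_le_ofReal hsum
    _ = ENNReal.ofReal c * ENNReal.ofReal r := ENNReal.ofReal_mul hc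
    _ ≤ _ := by gcongr; exact hr.ofReal_le_curveLength

theorem ofReal_mul_curveLength_le {c : ℝ} (hc : 0 ≤ c) (h : ∀ x y, c * d₂ x y ≤ d₁ x y) :
    ENNReal.ofReal c * curveLength d₂ γ ≤ curveLength d₁ γ := by
  simp only [curveLength, ENNReal.mul_iSup, ← ENNReal.ofReal_mul hc, Finset.mul_sum]
  exact iSup_mono fun k => iSup_mono fun t => iSup_mono fun _ =>
    ENNReal.ofReal_le_ofReal (Finset.sum_le_sum fun i _ => h _ _)

end CurveLength

/-! ### The length identity -/

theorem exists_steinDivergence_le {n : ℕ} {γ : unitInterval → SPD n} (hγ : Continuous γ)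
    {ε : ℝ} (hε : 0 < ε) : ∃ δ > 0, ∀ s t : unitInterval, s < t → (t : ℝ) - s ≤ δ →
      steinDivergence (γ t) (γ s) ≤ ε := by
  have hcont : Continuous fun p : unitInterval × unitInterval =>
      steinDivergence (γ p.1) (γ p.2) :=
    continuous_steinDivergence.comp
      ((hγ.comp continuous_fst).prodMk (hγ.comp continuous_snd))
  obtain ⟨δ, hδ, h⟩ := Metric.uniformContinuous_iff.1
    (CompactSpace.uniformContinuous_of_continuous hcont) ε hε
  refine ⟨δ / 2, half_pos hδ, fun s t hst hts => ?_⟩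
  have hst' : (s : ℝ) < t := hst
  have hd : dist (t, s) (s, s) < δ := by
    rw [Prod.dist_eq, dist_self, max_eq_left dist_nonneg, Subtype.dist_eq, Real.dist_eq,
      abs_of_pos (sub_pos.2 hst')]
    linarith
  have := h hd
  rw [steinDivergence_self, Real.dist_eq, sub_zero] at this
  exact (le_abs_self _).trans this.le

theorem theorem1 (n : ℕ) (γ : unitInterval → SPD n) (hγ : Continuous γ) :
    curveLength airmDist γ = ENNReal.ofReal (2 * Real.sqrt 2) * curveLength steinDist γ := by
  have h22 : 0 < 2 * Real.sqrt 2 := by positivity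
  refine le_antisymm ?_
    (ofReal_mul_curveLength_le h22.le two_sqrt_two_mul_steinDist_le_airmDist)
  have hle : ∀ κ : ℝ, 0 < κ → curveLength airmDist γ
      ≤ ENNReal.ofReal (Real.sqrt (8 * (1 + κ))) * curveLength steinDist γ := by
    intro κ hκ
    obtain ⟨δ, hδ, h⟩ := exists_steinDivergence_le hγ (Real.log_pos (by linarith : 1 < 1 + κ))
    exact curveLength_le_of_local_le (Real.sqrt_nonneg _) airmDist_triangle airmDist_self_le hδ
      fun s t hst hts => airmDist_le_mul_steinDist hκ (h s t hst hts)
  rcases eq_or_ne (curveLength steinDist γ) ⊤ with htop | htop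
  · rw [htop, ENNReal.mul_top (by simp)]
    exact le_top
  · have h8 : 2 * Real.sqrt 2 = Real.sqrt (8 * (1 + 0)) := by
      rw [show (8 : ℝ) * (1 + 0) = 2 ^ 2 * 2 by norm_num, Real.sqrt_mul (by norm_num),
        Real.sqrt_sq (by norm_num)]
    have hcont : Continuous fun κ : ℝ => ENNReal.ofReal (Real.sqrt (8 * (1 + κ))) :=
      ENNReal.continuous_ofReal.comp (by fun_prop)
    have hlim := ENNReal.Tendsto.mul_const (b := curveLength steinDist γ)
      ((hcont.tendsto 0).mono_left (nhdsWithin_le_nhds (s := Set.Ioi 0))) (Or.inr htop)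
    rw [h8]
    exact ge_of_tendsto hlim (Filter.eventually_of_mem self_mem_nhdsWithin hle)
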